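/- Let $A$ be a commutative ring. A complex of $A$-modules is called perfect if it is quasi-isomorphic (i.e. isomorphic in the derived category of $A$) to a finite complex $0\to P^a\to\cdots\to P^b\to 0$ of finitely generated projective $A$-modules; such a finite complex of finitely generated projective modules is said to have length $\le r$ if its degrees can be chosen with $b-a\le r$. The ring $A$ is called strongly $r$-regular if every perfect complex over $A$ is quasi-isomorphic to a finite direct sum of finite complexes of finitely generated projective $A$-modules of length $\le r$, and strongly regular if it is strongly $r$-regular for some integer $r\ge 0$. Corollary 1.7. A commutative noetherian local ring $A$ is strongly regular if and only if it is a field or a regular local ring of Krull dimension $1$. Here $A$ is a regular local ring of Krull dimension $1$ if and only if it is a discrete valuation ring. -/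

import Mathlib

open CategoryTheory CategoryTheory.Limits

universe u

/-- Finite direct sums exist in the abelian category of cochain complexes of `A`-modules. -/
instance instHasFiniteBiproductsCochainComplex {A : Type u} [Ring A] :
    HasFiniteBiproducts (CochainComplex (ModuleCat.{u} A) ℤ) :=
  Abelian.hasFiniteBiproducts

/-- Two cochain complexes of `A`-modules are quasi-isomorphic if they become isomorphic in the
derived category `D(A)`. -/
def QuasiIsomorphic {A : Type u} [Ring A] (K L : CochainComplex (ModuleCat.{u} A) ℤ) : Prop :=
  letI : HasDerivedCategory (ModuleCat.{u} A) := HasDerivedCategory.standard _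
  Nonempty ((DerivedCategory.Q (C := ModuleCat.{u} A)).obj K ≅ DerivedCategory.Q.obj L)

/-- `0 → K^a → ⋯ → K^b → 0`: a complex of finitely generated projective `A`-modules that is
concentrated in the degrees of the interval `[a, b]`. -/
structure IsFiniteProjectiveComplex {A : Type u} [Ring A]
    (K : CochainComplex (ModuleCat.{u} A) ℤ) (a b : ℤ) : Prop where
  finite : ∀ i, Module.Finite A (K.X i)
  projective : ∀ i, Module.Projective A (K.X i)
  isZero_of_lt : ∀ i, i < a → IsZero (K.X i)
  isZero_of_gt : ∀ i, b < i → IsZero (K.X i)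

/-- A perfect complex: a complex of `A`-modules that is quasi-isomorphic to a finite complex of
finitely generated projective `A`-modules. -/
def IsPerfectComplex {A : Type u} [Ring A] (K : CochainComplex (ModuleCat.{u} A) ℤ) : Prop :=
  ∃ (P : CochainComplex (ModuleCat.{u} A) ℤ) (a b : ℤ),
    IsFiniteProjectiveComplex P a b ∧ QuasiIsomorphic K P

/-- `K` is a finite complex `0 → K^a → ⋯ → K^b → 0` of finitely generated projective modules
whose length `b - a` is at most `r`. -/
def IsFiniteProjectiveOfLengthLE {A : Type u} [Ring A]
    (K : CochainComplex (ModuleCat.{u} A) ℤ) (r : ℕ) : Prop :=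
  ∃ a b : ℤ, b - a ≤ r ∧ IsFiniteProjectiveComplex K a b

/-- `A` is strongly `r`-regular: every perfect complex over `A` is quasi-isomorphic to a (finite)
direct sum of perfect complexes of length at most `r`. -/
def IsStronglyRRegular (A : Type u) [Ring A] (r : ℕ) : Prop :=
  ∀ K : CochainComplex (ModuleCat.{u} A) ℤ, IsPerfectComplex K →
    ∃ (s : ℕ) (F : Fin s → CochainComplex (ModuleCat.{u} A) ℤ),
      (∀ i, IsFiniteProjectiveOfLengthLE (F i) r) ∧ QuasiIsomorphic K (⨁ F)

/-- `A` is strongly regular: it is strongly `r`-regular for some `r`. -/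
def IsStronglyRegular (A : Type u) [Ring A] : Prop :=
  ∃ r : ℕ, IsStronglyRRegular A r

/-! Let `D` be a 2×2 matrix of square zero with entries in an ideal `I ≤ 𝔪`, and let `φ : I → k` be
linear with `φ(D)` invertible over the residue field `k`. In the complex `A² → ⋯ → A²` in degrees
`0, …, r + 1` with all differentials `D`, a chain endomorphism has components whose residues are
conjugate under `φ(D)`. If the complex were a sum of complexes of length at most `r`, its identity
would be homotopic to a sum of maps through these; each vanishes in degree `0` or `r + 1`, hence
modulo `𝔪` in degree `0`, and so would the identity (`not_isStronglyRegular_of_isUnit_map`). Such a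
`D` exists when a nonzero socle element lies in `𝔪`, or when a regular `a ∈ 𝔪` and some `b` do not
divide one another. Excluding both leaves a field or a principal `𝔪` with regular generator, hence a
discrete valuation ring. Conversely, over a principal ideal domain the coboundaries are projective,
so complexes split into two-term pieces. -/

namespace CochainComplex.IsKProjective

/-! ### Lifting from the derived category to chain maps up to homotopy. -/

variable {C : Type*} [Category C] [Abelian C] [HasDerivedCategory C]

theorem Q_map_surjective (K L : CochainComplex C ℤ) [K.IsKProjective] :
    Function.Surjective ((DerivedCategory.Q (C := C)).map : (K ⟶ L) → _) := by
  intro α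
  obtain ⟨g, hg⟩ := (Qh_map_bijective K ((HomotopyCategory.quotient _ _).obj L)).surjective
    ((DerivedCategory.quotientCompQhIso C).hom.app K ≫ α ≫
      (DerivedCategory.quotientCompQhIso C).inv.app L)
  obtain ⟨g, rfl⟩ := (HomotopyCategory.quotient _ _).map_surjective g
  refine ⟨g, ?_⟩
  have h := (DerivedCategory.quotientCompQhIso C).hom.naturality g
  rw [Functor.comp_map, hg] at h
  simpa using h.symm

theorem nonempty_homotopy_of_Q_map_eq {K L : CochainComplex C ℤ} [K.IsKProjective]
    {f g : K ⟶ L} (h : (DerivedCategory.Q (C := C)).map f = DerivedCategory.Q.map g) :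
    Nonempty (Homotopy f g) := by
  refine ⟨HomotopyCategory.homotopyOfEq _ _
    ((Qh_map_bijective K ((HomotopyCategory.quotient _ _).obj L)).injective ?_)⟩
  have e := DerivedCategory.quotientCompQhIso C
  change (HomotopyCategory.quotient _ _ ⋙ DerivedCategory.Qh).map f =
    (HomotopyCategory.quotient _ _ ⋙ DerivedCategory.Qh).map g
  rw [← cancel_mono (e.hom.app L), e.hom.naturality, e.hom.naturality, h]

end CochainComplex.IsKProjective

/-- The isomorphism lifts to a chain map out of `K`, and its inverse is lifted one summand at a
time, so K-projectivity of `⨁ F` itself is not needed. -/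
theorem QuasiIsomorphic.exists_homotopy_sum {A : Type u} [Ring A]
    {K : CochainComplex (ModuleCat.{u} A) ℤ} {s : ℕ}
    {F : Fin s → CochainComplex (ModuleCat.{u} A) ℤ} [K.IsKProjective] [∀ j, (F j).IsKProjective]
    (h : QuasiIsomorphic K (⨁ F)) :
    ∃ (f : ∀ j, K ⟶ F j) (g : ∀ j, F j ⟶ K), Nonempty (Homotopy (𝟙 K) (∑ j, f j ≫ g j)) := by
  let _ : HasDerivedCategory (ModuleCat.{u} A) := HasDerivedCategory.standard _
  obtain ⟨α⟩ : Nonempty ((DerivedCategory.Q (C := ModuleCat.{u} A)).obj K ≅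
    DerivedCategory.Q.obj (⨁ F)) := h
  obtain ⟨f, hf⟩ := CochainComplex.IsKProjective.Q_map_surjective K (⨁ F) α.hom
  choose g hg using fun j ↦ CochainComplex.IsKProjective.Q_map_surjective (F j) K
    (DerivedCategory.Q.map (biproduct.ι F j) ≫ α.inv)
  refine ⟨fun j ↦ f ≫ biproduct.π F j, g,
    CochainComplex.IsKProjective.nonempty_homotopy_of_Q_map_eq ?_⟩
  have key : DerivedCategory.Q.map (∑ j, biproduct.π F j ≫ g j) = α.inv := by
    rw [Functor.map_sum]
    simp only [Functor.map_comp, hg]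
    simp only [← Category.assoc, ← Functor.map_comp, ← Preadditive.sum_comp, ← Functor.map_sum]
    rw [biproduct.total]
    simp
  simp only [Category.assoc, ← Preadditive.comp_sum]
  rw [Functor.map_comp, key, hf]
  simp

theorem IsFiniteProjectiveComplex.isKProjective {A : Type u} [Ring A]
    {K : CochainComplex (ModuleCat.{u} A) ℤ} {a b : ℤ} (h : IsFiniteProjectiveComplex K a b) :
    K.IsKProjective := by
  have : K.IsStrictlyLE b := (CochainComplex.isStrictlyLE_iff K b).2 h.isZero_of_gt
  have (n : ℤ) : Projective (K.X n) := by
    have := h.projective n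
    exact (K.X n).projective_of_categoryTheory_projective
  exact CochainComplex.isKProjective_of_projective K b

theorem QuasiIsomorphic.refl {A : Type u} [Ring A] (K : CochainComplex (ModuleCat.{u} A) ℤ) :
    QuasiIsomorphic K K :=
  ⟨Iso.refl _⟩

theorem QuasiIsomorphic.trans_iso {A : Type u} [Ring A]
    {K L M : CochainComplex (ModuleCat.{u} A) ℤ} (h : QuasiIsomorphic K L) (e : L ≅ M) :
    QuasiIsomorphic K M := by
  let _ : HasDerivedCategory (ModuleCat.{u} A) := HasDerivedCategory.standard _
  exact h.map (· ≪≫ DerivedCategory.Q.mapIso e)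

/-! ### Complexes with constant differential. -/

section PeriodicComplex

variable {A : Type u} [CommRing A] {M : Type u} [AddCommGroup M] [Module A M]

/-- The differential of `periodicComplex`. -/
def periodicComplexD (D : M →ₗ[A] M) (n : ℕ) (i j : ℤ) :
    (PLift (0 ≤ i ∧ i ≤ n) → M) →ₗ[A] (PLift (0 ≤ j ∧ j ≤ n) → M) :=
  LinearMap.pi fun h ↦
    if h' : j = i + 1 ∧ 0 ≤ i then
      D ∘ₗ LinearMap.proj ⟨h'.2, by have := h.down; lia⟩
    else 0

theorem periodicComplexD_apply (D : M →ₗ[A] M) (n : ℕ) {i j : ℤ} (h' : j = i + 1 ∧ 0 ≤ i)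
    (x : PLift (0 ≤ i ∧ i ≤ n) → M) (h : PLift (0 ≤ j ∧ j ≤ n)) :
    periodicComplexD D n i j x h = D (x ⟨h'.2, by have := h.down; lia⟩) := by
  rw [periodicComplexD, LinearMap.pi_apply, dif_pos h']
  rfl

theorem periodicComplexD_eq_zero (D : M →ₗ[A] M) (n : ℕ) {i j : ℤ} (h' : ¬ (j = i + 1 ∧ 0 ≤ i)) :
    periodicComplexD D n i j = 0 := by
  refine LinearMap.ext fun x ↦ funext fun h ↦ ?_
  rw [periodicComplexD, LinearMap.pi_apply, dif_neg h']
  rfl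

/-- The complex `M → M → ⋯ → M` concentrated in degrees `0, …, n` all of whose differentials
are a given endomorphism `D` of square zero. -/
def periodicComplex (D : M →ₗ[A] M) (hD : D ∘ₗ D = 0) (n : ℕ) :
    CochainComplex (ModuleCat.{u} A) ℤ where
  -- Functions on a proposition: a copy of `M` where it holds and the zero module elsewhere, with no
  -- transport between degrees.
  X i := ModuleCat.of A (PLift (0 ≤ i ∧ i ≤ n) → M)
  d i j := ModuleCat.ofHom (periodicComplexD D n i j)
  shape i j hij := by
    rw [periodicComplexD_eq_zero D n (fun h ↦ hij h.1.symm)]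
    rfl
  d_comp_d' i j k hij hjk := by
    simp only [ComplexShape.up_Rel] at hij hjk
    rw [← ModuleCat.ofHom_comp]
    by_cases hi : 0 ≤ i
    · refine ModuleCat.hom_ext (LinearMap.ext fun x ↦ funext fun h ↦ ?_)
      change periodicComplexD D n j k (periodicComplexD D n i j x) h = 0
      rw [periodicComplexD_apply D n ⟨hjk.symm, by lia⟩,
        periodicComplexD_apply D n ⟨hij.symm, hi⟩]
      exact LinearMap.congr_fun hD _
    · rw [periodicComplexD_eq_zero D n (fun h ↦ hi h.2), LinearMap.comp_zero]
      rfl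

variable (D : M →ₗ[A] M) (hD : D ∘ₗ D = 0) (n : ℕ)

theorem isFiniteProjectiveComplex_periodicComplex [Module.Finite A M] [Module.Free A M] :
    IsFiniteProjectiveComplex (periodicComplex D hD n) 0 n where
  finite i := inferInstanceAs (Module.Finite A (PLift (0 ≤ i ∧ i ≤ n) → M))
  projective i := by
    have : Module.Free A (PLift (0 ≤ i ∧ i ≤ n) → M) := inferInstance
    exact inferInstanceAs (Module.Projective A (PLift (0 ≤ i ∧ i ≤ n) → M))
  isZero_of_lt i hi := by
    have : IsEmpty (PLift (0 ≤ i ∧ i ≤ n)) := ⟨fun h ↦ by have := h.down; lia⟩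
    exact ModuleCat.isZero_of_iff_subsingleton.2
      (inferInstanceAs (Subsingleton (PLift (0 ≤ i ∧ i ≤ n) → M)))
  isZero_of_gt i hi := by
    have : IsEmpty (PLift (0 ≤ i ∧ i ≤ n)) := ⟨fun h ↦ by have := h.down; lia⟩
    exact ModuleCat.isZero_of_iff_subsingleton.2
      (inferInstanceAs (Subsingleton (PLift (0 ≤ i ∧ i ≤ n) → M)))

namespace periodicComplex

/-- The identification of `M` with the component of `periodicComplex D hD n` in a
degree `i ≤ n`. -/
def xEquiv (i : ℕ) (hi : i ≤ n) : (periodicComplex D hD n).X i ≃ₗ[A] M where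
  toFun x := (x : PLift (0 ≤ (i : ℤ) ∧ (i : ℤ) ≤ n) → M) ⟨by lia⟩
  map_add' _ _ := rfl
  map_smul' _ _ := rfl
  invFun m := fun _ ↦ m
  left_inv _ := rfl
  right_inv _ := rfl

theorem xEquiv_d (i : ℕ) (hi : i + 1 ≤ n) (x : (periodicComplex D hD n).X i) :
    xEquiv D hD n (i + 1) hi ((periodicComplex D hD n).d i (i + 1 : ℕ) x) =
      D (xEquiv D hD n i (by lia) x) :=
  periodicComplexD_apply D n ⟨by lia, by lia⟩ x ⟨by lia⟩

variable {D hD n}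

/-- The endomorphism of `M` induced in degree `i` by an endomorphism of `periodicComplex D hD n`. -/
def endo (e : periodicComplex D hD n ⟶ periodicComplex D hD n) (i : ℕ) (hi : i ≤ n) :
    M →ₗ[A] M :=
  (xEquiv D hD n i hi).toLinearMap ∘ₗ (e.f i).hom ∘ₗ (xEquiv D hD n i hi).symm.toLinearMap

theorem endo_comp (e : periodicComplex D hD n ⟶ periodicComplex D hD n) (i : ℕ) (hi : i + 1 ≤ n) :
    endo e (i + 1) hi ∘ₗ D = D ∘ₗ endo e i (by lia) := by
  refine LinearMap.ext fun m ↦ ?_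
  obtain ⟨x, rfl⟩ := (xEquiv D hD n i (by lia)).surjective m
  have h := ConcreteCategory.congr_hom (e.comm i (i + 1 : ℕ)) x
  simp only [ModuleCat.comp_apply] at h
  simp only [endo, LinearMap.comp_apply, LinearEquiv.coe_coe, LinearEquiv.symm_apply_apply]
  rw [← xEquiv_d (hi := hi), LinearEquiv.symm_apply_apply]
  refine (congrArg (xEquiv D hD n (i + 1) hi) h.symm).trans ?_
  exact xEquiv_d D hD n i hi _

theorem endo_eq_zero {e : periodicComplex D hD n ⟶ periodicComplex D hD n} {i : ℕ} (hi : i ≤ n)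
    (h : e.f i = 0) : endo e i hi = 0 := by
  rw [endo, h]
  simp

theorem endo_sum {ι : Type*} (s : Finset ι)
    (e : ι → (periodicComplex D hD n ⟶ periodicComplex D hD n)) (i : ℕ) (hi : i ≤ n) :
    endo (∑ j ∈ s, e j) i hi = ∑ j ∈ s, endo (e j) i hi := by
  refine LinearMap.ext fun m ↦ ?_
  have h : (∑ j ∈ s, e j).f i = ∑ j ∈ s, (e j).f i :=
    Functor.map_sum (HomologicalComplex.eval _ _ (i : ℤ)) e s
  simp [endo, h]

/-- In degree zero, an endomorphism homotopic to the identity is the identity up to a multiple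
of `D`. -/
theorem exists_endo_zero_eq (hn : 1 ≤ n) {e : periodicComplex D hD n ⟶ periodicComplex D hD n}
    (h : Homotopy (𝟙 _) e) : ∃ f : M →ₗ[A] M, LinearMap.id = f ∘ₗ D + endo e 0 (by lia) := by
  have hz : (periodicComplex D hD n).d (-1) 0 = 0 :=
    congrArg ModuleCat.ofHom (periodicComplexD_eq_zero D n (by lia))
  have hc := h.comm (0 : ℕ)
  rw [dNext_eq h.hom (show (ComplexShape.up ℤ).Rel (0 : ℕ) (0 + 1 : ℕ) by simp),
    prevD_eq h.hom (show (ComplexShape.up ℤ).Rel (-1) (0 : ℕ) by simp)] at hc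
  refine ⟨(xEquiv D hD n 0 (by lia)).toLinearMap ∘ₗ (h.hom (0 + 1 : ℕ) (0 : ℕ)).hom ∘ₗ
    (xEquiv D hD n (0 + 1) hn).symm.toLinearMap, LinearMap.ext fun m ↦ ?_⟩
  obtain ⟨x, rfl⟩ := (xEquiv D hD n 0 (by lia)).surjective m
  have hx := ConcreteCategory.congr_hom hc x
  simp only [LinearMap.add_apply, LinearMap.comp_apply, LinearEquiv.coe_coe, endo,
    LinearEquiv.symm_apply_apply, LinearMap.id_apply]
  rw [← xEquiv_d (hi := hn), LinearEquiv.symm_apply_apply, ← map_add]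
  refine congrArg _ (hx.trans ?_)
  simp [hz]

end periodicComplex
end PeriodicComplex

/-! ### The obstruction to strong regularity. -/

/-- Entrywise, both sides of `h` are `A`-linear combinations of entries of `D`, so `φ` reduces only
the coefficients. Reducing `h` itself modulo `𝔪` would lose everything when `I ≤ 𝔪`. -/
theorem Matrix.map_residue_mul_map_of_mul_eq {A : Type*} [CommRing A] [IsLocalRing A] {ι : Type*}
    [Fintype ι] {I : Ideal A}
    (φ : I →ₗ[A] IsLocalRing.ResidueField A) {D : Matrix ι ι I} {E E' : Matrix ι ι A}
    (h : E' * D.map (↑) = D.map (↑) * E) :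
    E'.map (IsLocalRing.residue A) * D.map φ = D.map φ * E.map (IsLocalRing.residue A) := by
  ext i j
  have h1 : ∑ l, E' i l • D l j = ∑ l, E l j • D i l := by
    ext
    simpa [Matrix.mul_apply, mul_comm] using congrFun (congrFun h i) j
  have h2 := congrArg φ h1
  simp only [map_sum, map_smul, Algebra.smul_def] at h2
  simpa [Matrix.mul_apply, mul_comm] using h2

/-- A local ring is not strongly regular as soon as there is a matrix of square zero with
coefficients in an ideal `I ≤ 𝔪` whose image under some linear map from `I` to the residue field
is invertible. -/
theorem not_isStronglyRegular_of_isUnit_map {A : Type u} [CommRing A] [IsLocalRing A]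
    {I : Ideal A} (hI : I ≤ IsLocalRing.maximalIdeal A) (D : Matrix (Fin 2) (Fin 2) I)
    (hD : D.map (Subtype.val : I → A) * D.map (Subtype.val : I → A) = 0)
    (φ : I →ₗ[A] IsLocalRing.ResidueField A) (hφ : IsUnit (D.map φ)) : ¬ IsStronglyRegular A := by
  rintro ⟨r, hr⟩
  set D' := D.map (Subtype.val : I → A)
  have hD' : D'.toLin' ∘ₗ D'.toLin' = 0 := by rw [← Matrix.toLin'_mul, hD, map_zero]
  have hK := isFiniteProjectiveComplex_periodicComplex D'.toLin' hD' (r + 1)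
  obtain ⟨s, F, hF, hq⟩ := hr (periodicComplex D'.toLin' hD' (r + 1)) ⟨_, _, _, hK, .refl _⟩
  have := hK.isKProjective
  have (j : Fin s) : (F j).IsKProjective :=
    let ⟨_, _, _, h⟩ := hF j
    h.isKProjective
  obtain ⟨f, g, ⟨H⟩⟩ := hq.exists_homotopy_sum
  let E (j : Fin s) (i : ℕ) (hi : i ≤ r + 1) : Matrix (Fin 2) (Fin 2) (IsLocalRing.ResidueField A) :=
    (LinearMap.toMatrix' (periodicComplex.endo (f j ≫ g j) i hi)).map (IsLocalRing.residue A)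
  have hE (j : Fin s) (i : ℕ) (hi : i ≤ r + 1) :
      E j i hi * D.map φ ^ i = D.map φ ^ i * E j 0 (by lia) := by
    induction i with
    | zero => simp
    | succ i ih =>
      have hc := congrArg LinearMap.toMatrix' (periodicComplex.endo_comp (f j ≫ g j) i hi)
      rw [LinearMap.toMatrix'_comp, LinearMap.toMatrix'_comp, LinearMap.toMatrix'_toLin'] at hc
      have hc' : E j (i + 1) hi * D.map φ = D.map φ * E j i (by lia) :=
        Matrix.map_residue_mul_map_of_mul_eq φ hc
      rw [pow_succ', ← mul_assoc, hc', mul_assoc, ih, mul_assoc]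
  have hE0 (j : Fin s) : E j 0 (by lia) = 0 := by
    rw [← (hφ.pow (r + 1)).mul_right_eq_zero, ← hE j (r + 1) le_rfl]
    -- As `b - a ≤ r`, either `0 < a` or `b < r + 1`, so `F j` misses one of the two end degrees.
    obtain ⟨a, b, hab, h⟩ := hF j
    by_cases ha : 0 < a
    · have : (f j ≫ g j).f (0 : ℕ) = 0 := by
        rw [HomologicalComplex.comp_f]
        exact (h.isZero_of_lt _ ha).eq_zero_of_tgt (f := (f j).f 0) ▸ zero_comp
      rw [hE]
      simp [E, periodicComplex.endo_eq_zero _ this]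
    · have : (f j ≫ g j).f (r + 1 : ℕ) = 0 := by
        rw [HomologicalComplex.comp_f, (h.isZero_of_gt (r + 1 : ℕ) (by lia)).eq_zero_of_tgt
          ((f j).f (r + 1 : ℕ)), zero_comp]
      simp [E, periodicComplex.endo_eq_zero _ this]
  obtain ⟨p, hp⟩ := periodicComplex.exists_endo_zero_eq (by lia) H
  have hp' := congrArg (fun p ↦ (LinearMap.toMatrix' p).map (IsLocalRing.residue A)) hp
  -- The homotopy term is a multiple of `D'`, so it dies modulo `𝔪`.
  have hDm : D'.map (IsLocalRing.residue A) = 0 := by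
    ext i j
    exact (IsLocalRing.residue_eq_zero_iff _).2 (hI (D i j).2)
  simp only [map_add, LinearMap.toMatrix'_comp, LinearMap.toMatrix'_toLin',
    periodicComplex.endo_sum, map_sum, LinearMap.toMatrix'_id] at hp'
  have hmap (X : Matrix (Fin 2) (Fin 2) A) : X.map (IsLocalRing.residue A) =
    (IsLocalRing.residue A).mapMatrix X := rfl
  rw [hmap, hmap, map_add, map_mul, map_one, map_sum, ← hmap D', hDm, mul_zero, zero_add] at hp'
  refine one_ne_zero (hp'.trans (Finset.sum_eq_zero fun j _ ↦ hE0 j))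

/-! ### Square-zero matrices and principality of the maximal ideal. -/

open IsLocalRing

/-- The quotient of `I` by its intersection with `J + 𝔪I` is a vector space over the residue field
in which `z` is nonzero; a functional nonzero at `z` is rescaled. -/
theorem exists_linearMap_residueField {A : Type*} [CommRing A] [IsLocalRing A] {I J : Ideal A}
    {z : A} (hz : z ∈ I) (hzJ : z ∉ J ⊔ maximalIdeal A * I) :
    ∃ φ : I →ₗ[A] ResidueField A, φ ⟨z, hz⟩ = 1 ∧ ∀ x : I, (x : A) ∈ J → φ x = 0 := by
  let N : Submodule A I := Submodule.comap (Submodule.subtype I) (J ⊔ maximalIdeal A * I)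
  have ht : Module.IsTorsionBySet A (I ⧸ N) (maximalIdeal A : Set A) := by
    rintro x ⟨a, ha⟩
    obtain ⟨x, rfl⟩ := N.mkQ_surjective x
    rw [← map_smul]
    exact (Submodule.Quotient.mk_eq_zero N).2 (Ideal.mem_sup_right (Ideal.mul_mem_mul ha x.2))
  let _ : Module (ResidueField A) (I ⧸ N) := ht.module
  have : IsScalarTower A (ResidueField A) (I ⧸ N) := ht.isScalarTower
  have hne : N.mkQ ⟨z, hz⟩ ≠ 0 := fun h ↦ hzJ ((Submodule.Quotient.mk_eq_zero N).1 h)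
  obtain ⟨f, hf⟩ : ∃ f : Module.Dual (ResidueField A) (I ⧸ N), f (N.mkQ ⟨z, hz⟩) ≠ 0 := by
    by_contra! h
    exact hne ((Module.forall_dual_apply_eq_zero_iff _ _).1 h)
  refine ⟨((f (N.mkQ ⟨z, hz⟩))⁻¹ • f).restrictScalars A ∘ₗ N.mkQ, inv_mul_cancel₀ hf, fun x hx ↦ ?_⟩
  have : N.mkQ x = 0 := (Submodule.Quotient.mk_eq_zero N).2 (Ideal.mem_sup_left hx)
  simp only [LinearMap.comp_apply, this, map_zero]

/-- If `a` is regular and `(a, b)` is not principal, then the quadratic form `Y² - XZ` does not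
vanish identically on the dual of the cotangent space of `(a, b)²` at `(a², ab, b²)`. -/
theorem exists_linearMap_discrim_ne_zero {A : Type*} [CommRing A] [IsLocalRing A] {a b : A}
    (ha : a ∈ nonZeroDivisors A) (hab : ¬ a ∣ b) (hba : ¬ b ∣ a) {I : Ideal A}
    (hI : I = Ideal.span {a * b, a * a, b * b})
    (hp : a * b ∈ I) (hq : a * a ∈ I) (hr : b * b ∈ I) :
    ∃ φ : I →ₗ[A] ResidueField A,
      φ ⟨a * b, hp⟩ * φ ⟨a * b, hp⟩ - φ ⟨a * a, hq⟩ * φ ⟨b * b, hr⟩ ≠ 0 := by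
  have hfg : I.FG := by
    rw [hI]
    exact Submodule.fg_span (Set.toFinite _)
  have nak (J : Ideal A) (h : I ≤ J ⊔ maximalIdeal A * I) : I ≤ J :=
    Submodule.le_of_le_smul_of_le_jacobson_bot hfg (maximalIdeal_le_jacobson _) h
  have hIle (J : Ideal A) (h1 : a * b ∈ J) (h2 : a * a ∈ J) (h3 : b * b ∈ J) : I ≤ J := by
    rw [hI, Ideal.span_le]
    rintro x (rfl | rfl | rfl) <;> assumption
  -- If this fails, some `φ` has `Y = 1` and `X = Z = 0`. Otherwise Nakayama gives `I = (a², b²)`.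
  by_cases h1 : a * b ∈ Ideal.span {a * a, b * b} ⊔ maximalIdeal A * I
  swap
  · obtain ⟨φ, hφ, hφ'⟩ := exists_linearMap_residueField hp h1
    refine ⟨φ, ?_⟩
    rw [hφ, hφ' ⟨a * a, hq⟩ (Ideal.subset_span (by simp))]
    simp
  have hI2 : I ≤ Ideal.span {a * a, b * b} := nak _ (hIle _ h1
    (Ideal.mem_sup_left (Ideal.subset_span (by simp)))
    (Ideal.mem_sup_left (Ideal.subset_span (by simp))))
  have hIle2 (J : Ideal A) (h2 : a * a ∈ J) (h3 : b * b ∈ J) : I ≤ J := by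
    refine hI2.trans (Ideal.span_le.2 ?_)
    rintro x (rfl | rfl) <;> assumption
  -- Otherwise `I = (b²)` by Nakayama; then `b` is regular because `a²` is, and cancelling it in `ab
  -- = tb²` gives `b ∣ a`.
  have hq' : a * a ∉ Ideal.span {b * b} ⊔ maximalIdeal A * I := by
    intro h
    have hle := nak _ (hIle2 _ h (Ideal.mem_sup_left (Ideal.subset_span (by simp))))
    obtain ⟨s, hs⟩ := Ideal.mem_span_singleton'.1 (hle hq)
    obtain ⟨t, ht⟩ := Ideal.mem_span_singleton'.1 (hle hp)
    have hb : b ∈ nonZeroDivisors A := by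
      have : s * b * b ∈ nonZeroDivisors A := by
        rw [mul_assoc, hs]
        exact mul_mem ha ha
      exact (mul_mem_nonZeroDivisors.1 this).2
    exact hba ⟨t, (mul_cancel_right_mem_nonZeroDivisors hb).1 (by rw [← ht]; ring)⟩
  have hr' : b * b ∉ Ideal.span {a * a} ⊔ maximalIdeal A * I := by
    intro h
    have hle := nak _ (hIle2 _ (Ideal.mem_sup_left (Ideal.subset_span (by simp))) h)
    obtain ⟨t, ht⟩ := Ideal.mem_span_singleton'.1 (hle hp)
    exact hab ⟨t, (mul_cancel_left_mem_nonZeroDivisors ha).1 (by rw [← ht]; ring)⟩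
  obtain ⟨φ, hφ, hφ'⟩ := exists_linearMap_residueField hq hq'
  obtain ⟨ψ, hψ, hψ'⟩ := exists_linearMap_residueField hr hr'
  replace hφ' := hφ' ⟨b * b, hr⟩ (Ideal.subset_span (by simp))
  replace hψ' := hψ' ⟨a * a, hq⟩ (Ideal.subset_span (by simp))
  -- `φ` has `Z = 0` and `ψ` has `X = 0`, so either works if its `Y` is nonzero; if both vanish, `φ
  -- + ψ` gives `-1`.
  by_cases h2 : φ ⟨a * b, hp⟩ = 0
  · by_cases h3 : ψ ⟨a * b, hp⟩ = 0
    · exact ⟨φ + ψ, by simp [*]⟩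
    · exact ⟨ψ, by simp [*]⟩
  · exact ⟨φ, by simp [*]⟩

theorem not_isStronglyRegular_of_not_dvd {A : Type u} [CommRing A] [IsLocalRing A] {a b : A}
    (ha : a ∈ nonZeroDivisors A) (ham : a ∈ maximalIdeal A) (hab : ¬ a ∣ b) (hba : ¬ b ∣ a) :
    ¬ IsStronglyRegular A := by
  obtain ⟨I, hI⟩ : ∃ I, I = Ideal.span {a * b, a * a, b * b} := ⟨_, rfl⟩
  have hbm : b ∈ maximalIdeal A := by
    rw [mem_maximalIdeal, mem_nonunits_iff]
    exact fun h ↦ hba h.dvd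
  have hp : a * b ∈ I := hI ▸ Ideal.subset_span (by simp)
  have hq : a * a ∈ I := hI ▸ Ideal.subset_span (by simp)
  have hr : b * b ∈ I := hI ▸ Ideal.subset_span (by simp)
  obtain ⟨φ, hφ⟩ := exists_linearMap_discrim_ne_zero ha hab hba hI hp hq hr
  refine not_isStronglyRegular_of_isUnit_map (I := I) ?_
    -- The column `(a, b)` times the row `(b, -a)`; its square vanishes because the row times the
    -- column is `ba - ab = 0`.
    !![⟨a * b, hp⟩, -⟨a * a, hq⟩; ⟨b * b, hr⟩, -⟨a * b, hp⟩] ?_ φ ?_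
  · rw [hI, Ideal.span_le]
    rintro x (rfl | rfl | rfl)
    exacts [Ideal.mul_mem_left _ _ hbm, Ideal.mul_mem_left _ _ ham, Ideal.mul_mem_left _ _ hbm]
  · ext i j
    fin_cases i <;> fin_cases j <;> simp [Matrix.mul_apply] <;> ring
  · rw [Matrix.isUnit_iff_isUnit_det, isUnit_iff_ne_zero, Matrix.det_fin_two]
    simp only [Matrix.map_apply, Matrix.of_apply, Matrix.cons_val', Matrix.cons_val_zero,
      Matrix.cons_val_one, Matrix.cons_val_fin_one, map_neg]
    intro h
    exact hφ (by linear_combination -h)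

theorem not_isStronglyRegular_of_socle {A : Type u} [CommRing A] [IsLocalRing A] {x : A}
    (hx : x ≠ 0) (hxm : x ∈ maximalIdeal A) (h : ∀ y ∈ maximalIdeal A, x * y = 0) :
    ¬ IsStronglyRegular A := by
  have hmem : x ∈ Ideal.span {x} := Ideal.mem_span_singleton_self x
  obtain ⟨φ, hφ, -⟩ := exists_linearMap_residueField (J := ⊥) hmem (by
    rw [bot_sup_eq, Ideal.mem_mul_span_singleton]
    rintro ⟨y, hy, hyx⟩
    exact hx (by rw [← hyx, mul_comm, h y hy]))
  refine not_isStronglyRegular_of_isUnit_map (I := Ideal.span {x}) ?_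
    (Matrix.diagonal fun _ ↦ ⟨x, hmem⟩) ?_ φ ?_
  · rwa [Ideal.span_singleton_le_iff_mem]
  · rw [Matrix.diagonal_map rfl, Matrix.diagonal_mul_diagonal]
    simp [h x hxm]
  · rw [Matrix.diagonal_map (map_zero φ), hφ, Matrix.diagonal_one]
    exact isUnit_one

/-- Otherwise prime avoidance makes `𝔪` an associated prime, the annihilator of some `x`. If `x` is
a unit then `𝔪 = 0`; if not, `x` is a socle element in `𝔪`. -/
theorem exists_mem_nonZeroDivisors_of_isStronglyRegular {A : Type u} [CommRing A] [IsLocalRing A]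
    [IsNoetherianRing A] (h : IsStronglyRegular A) (hA : ¬ IsField A) :
    ∃ a ∈ maximalIdeal A, a ∈ nonZeroDivisors A := by
  by_contra! hz
  have hsub : (maximalIdeal A : Set A) ⊆ ⋃ p ∈ associatedPrimes A A, p := by
    rw [biUnion_associatedPrimes_eq_compl_nonZeroDivisors]
    exact hz
  have hm : maximalIdeal A ∈ associatedPrimes A A := by
    obtain ⟨p, hp, hle⟩ := (Ideal.subset_union_prime_finite (associatedPrimes.finite A A) ⊥ ⊥
      (fun p hp _ _ ↦ hp.isPrime)).1 hsub
    rwa [(maximalIdeal.isMaximal A).eq_of_le hp.isPrime.ne_top hle]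
  obtain ⟨x, hx⟩ := (isAssociatedPrime_iff.1 hm).2
  have hx' (y : A) : y ∈ maximalIdeal A ↔ y * x = 0 := by
    rw [hx]
    simp [Submodule.mem_colon_singleton]
  have hx0 : x ≠ 0 := by
    rintro rfl
    exact (maximalIdeal.isMaximal A).ne_top ((Ideal.eq_top_iff_one _).2 ((hx' 1).2 (by simp)))
  refine not_isStronglyRegular_of_socle hx0 ?_
    (fun y hy ↦ by rw [mul_comm, (hx' y).1 hy]) h
  by_contra hxm
  rw [mem_maximalIdeal, mem_nonunits_iff, not_not] at hxm
  refine hA (isField_iff_maximalIdeal_eq.2 ((Submodule.eq_bot_iff _).2 fun y hy ↦ ?_))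
  exact hxm.mul_left_eq_zero.1 ((hx' y).1 hy)

/-- Take `(a)` maximal among principal ideals generated by regular elements of `𝔪`. For `b ∈ 𝔪` not
divisible by `a`, either `b ∣ a` and `(b)` is strictly larger, or neither divides the other. -/
theorem isPrincipal_maximalIdeal_of_isStronglyRegular {A : Type u} [CommRing A] [IsLocalRing A]
    [IsNoetherianRing A] (h : IsStronglyRegular A) (hA : ¬ IsField A) :
    ∃ a ∈ nonZeroDivisors A, maximalIdeal A = Ideal.span {a} := by
  obtain ⟨a₀, ham₀, ha₀⟩ := exists_mem_nonZeroDivisors_of_isStronglyRegular h hA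
  obtain ⟨_, ⟨a, ⟨ham, ha⟩, rfl⟩, hmax⟩ := set_has_maximal_iff_noetherian.2
    (inferInstance : IsNoetherian A A)
    ((fun a : A ↦ Ideal.span {a}) '' {a | a ∈ maximalIdeal A ∧ a ∈ nonZeroDivisors A})
    ⟨_, a₀, ⟨ham₀, ha₀⟩, rfl⟩
  refine ⟨a, ha, le_antisymm (fun b hb ↦ ?_) ((Ideal.span_singleton_le_iff_mem _).2 ham)⟩
  rw [Ideal.mem_span_singleton]
  by_contra hab
  by_cases hba : b ∣ a
  · obtain ⟨c, rfl⟩ := hba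
    refine hmax _ ⟨b, ⟨hb, (mul_mem_nonZeroDivisors.1 ha).1⟩, rfl⟩ (lt_of_le_not_ge ?_ ?_)
    · exact Ideal.span_singleton_le_span_singleton.2 (dvd_mul_right b c)
    · rwa [Ideal.span_singleton_le_span_singleton]
  · exact not_isStronglyRegular_of_not_dvd ha ham hab hba h

/-! ### Local rings with principal maximal ideal. -/

/-- By Krull's intersection theorem, only finitely many powers of `x` divide `a`. -/
theorem exists_isUnit_mul_pow_of_maximalIdeal_eq_span {A : Type*} [CommRing A] [IsLocalRing A]
    [IsNoetherianRing A] {x : A} (hx : maximalIdeal A = Ideal.span {x}) {a : A} (ha : a ≠ 0) :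
    ∃ (n : ℕ) (u : A), IsUnit u ∧ a = u * x ^ n := by
  classical
  have hex : ∃ n, ¬ x ^ n ∣ a := by
    by_contra! h
    refine ha ((Submodule.mem_bot A).1 ?_)
    rw [← Ideal.iInf_pow_eq_bot_of_isLocalRing _ (maximalIdeal.isMaximal A).ne_top,
      Submodule.mem_iInf]
    intro n
    rw [hx, Ideal.span_singleton_pow, Ideal.mem_span_singleton]
    exact h n
  have h0 : Nat.find hex ≠ 0 := fun h ↦ by
    have := Nat.find_spec hex
    rw [h] at this
    simp at this
  obtain ⟨n, hn⟩ := Nat.exists_eq_succ_of_ne_zero h0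
  obtain ⟨u, hu⟩ := not_not.1 (Nat.find_min hex (m := n) (by lia))
  refine ⟨n, u, ?_, by rw [hu, mul_comm]⟩
  by_contra hnu
  have hum : u ∈ maximalIdeal A := hnu
  rw [hx, Ideal.mem_span_singleton] at hum
  obtain ⟨v, rfl⟩ := hum
  refine Nat.find_spec hex ⟨v, ?_⟩
  rw [hn, hu, pow_succ, mul_assoc]

theorem isDiscreteValuationRing_of_maximalIdeal_eq_span {A : Type*} [CommRing A] [IsLocalRing A]
    [IsNoetherianRing A] {x : A} (hx : maximalIdeal A = Ideal.span {x}) (hn : ¬ IsNilpotent x) :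
    ∃ _ : IsDomain A, IsDiscreteValuationRing A := by
  have : NoZeroDivisors A := by
    refine ⟨fun {a b} hab ↦ ?_⟩
    by_contra! h
    obtain ⟨m, u, hu, rfl⟩ := exists_isUnit_mul_pow_of_maximalIdeal_eq_span hx h.1
    obtain ⟨n, v, hv, rfl⟩ := exists_isUnit_mul_pow_of_maximalIdeal_eq_span hx h.2
    refine hn ⟨m + n, ?_⟩
    rw [← (hu.mul hv).mul_right_eq_zero, ← hab]
    ring
  have hdom : IsDomain A := NoZeroDivisors.to_isDomain A
  refine ⟨hdom, ?_⟩
  have hA : ¬ IsField A := by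
    rw [isField_iff_maximalIdeal_eq, hx, Ideal.span_singleton_eq_bot]
    rintro rfl
    exact hn .zero
  exact ((IsDiscreteValuationRing.TFAE A hA).out 0 4 :
    IsDiscreteValuationRing A ↔ (maximalIdeal A).IsPrincipal).2 ⟨x, hx⟩

theorem isRegularLocalRing_and_ringKrullDim_eq_one_iff (A : Type*) [CommRing A] [IsLocalRing A]
    [IsNoetherianRing A] :
    (IsRegularLocalRing A ∧ ringKrullDim A = 1) ↔ ∃ _ : IsDomain A, IsDiscreteValuationRing A := by
  refine ⟨fun ⟨hreg, hdim⟩ ↦ ?_, fun ⟨_, _⟩ ↦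
    ⟨inferInstance, IsDiscreteValuationRing.ringKrullDim_eq_one A⟩⟩
  have h1 : (maximalIdeal A).spanFinrank = 1 := by
    have := hreg.spanFinrank_maximalIdeal
    rw [hdim] at this
    exact_mod_cast this
  obtain ⟨x, hx⟩ : ∃ x, maximalIdeal A = Ideal.span {x} := by
    obtain ⟨s, hs, hspan⟩ := Submodule.FG.exists_span_set_encard_eq_spanFinrank
      (maximalIdeal A).fg_of_isNoetherianRing
    rw [h1] at hs
    obtain ⟨x, rfl⟩ := Set.encard_eq_one.1 (by exact_mod_cast hs)
    exact ⟨x, hspan.symm⟩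
  -- A nilpotent `x` lies in every prime, which would force dimension at most zero.
  refine isDiscreteValuationRing_of_maximalIdeal_eq_span hx fun hn ↦ ?_
  have : Ring.KrullDimLE 0 A := by
    refine Ring.KrullDimLE.mk₀ fun p hp ↦ ?_
    have hle : maximalIdeal A ≤ p := by
      rw [hx, Ideal.span_singleton_le_iff_mem]
      obtain ⟨n, hn⟩ := hn
      exact hp.mem_of_pow_mem n (hn ▸ p.zero_mem)
    exact (maximalIdeal.isMaximal A).eq_of_le hp.ne_top hle ▸ maximalIdeal.isMaximal A
  have h0 := Ring.krullDimLE_iff.1 this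
  rw [hdim] at h0
  exact absurd h0 (by decide)

theorem isField_or_isRegularLocalRing_of_isStronglyRegular {A : Type u} [CommRing A]
    [IsLocalRing A] [IsNoetherianRing A] (h : IsStronglyRegular A) :
    IsField A ∨ (IsRegularLocalRing A ∧ ringKrullDim A = 1) := by
  by_cases hA : IsField A
  · exact .inl hA
  obtain ⟨a, ha, hspan⟩ := isPrincipal_maximalIdeal_of_isStronglyRegular h hA
  refine .inr ((isRegularLocalRing_and_ringKrullDim_eq_one_iff A).2
    (isDiscreteValuationRing_of_maximalIdeal_eq_span hspan fun ⟨n, hn⟩ ↦ ?_))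
  exact nonZeroDivisors.ne_zero (pow_mem ha n) hn

/-! ### Decomposing split complexes into two-term pieces. -/

namespace HomologicalComplex

section

variable {C : Type*} [Category C] [HasZeroMorphisms C] [HasZeroObject C] {X₀ X₁ : C} {f : X₀ ⟶ X₁}
  {ι : Type*} {c : ComplexShape ι} {i₀ i₁ : ι} (hi₀₁ : c.Rel i₀ i₁) (h : i₀ ≠ i₁)
  {K : HomologicalComplex C c} (φ₀ : K.X i₀ ⟶ X₀) (φ₁ : K.X i₁ ⟶ X₁)
  (comm : φ₀ ≫ f = K.d i₀ i₁ ≫ φ₁) (hφ : ∀ (k : ι), c.Rel k i₀ → K.d k i₀ ≫ φ₀ = 0)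

open scoped Classical in
/-- Constructor for morphisms from a homological complex to `double f hi₀₁`. -/
noncomputable def mkHomToDouble : K ⟶ double f hi₀₁ where
  f k :=
    if hk₀ : k = i₀ then
      eqToHom (by rw [hk₀]) ≫ φ₀ ≫ (doubleXIso₀ f hi₀₁).inv ≫ eqToHom (by rw [hk₀])
    else if hk₁ : k = i₁ then
      eqToHom (by rw [hk₁]) ≫ φ₁ ≫ (doubleXIso₁ f hi₀₁ h).inv ≫ eqToHom (by rw [hk₁])
    else 0
  comm' k₀ k₁ hk := by
    by_cases h₁ : k₁ = i₁
    · subst h₁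
      obtain rfl := c.prev_eq hk hi₀₁
      simp [dif_neg h.symm, double_d f hi₀₁ h, reassoc_of% comm]
    · by_cases h₀ : k₁ = i₀
      · subst h₀
        simp [double_d_eq_zero₁ _ _ _ _ h₁, reassoc_of% (hφ k₀ hk)]
      · exact (isZero_double_X f hi₀₁ k₁ h₀ h₁).eq_of_tgt _ _

@[simp]
lemma mkHomToDouble_f₀ :
    (mkHomToDouble hi₀₁ h φ₀ φ₁ comm hφ).f i₀ = φ₀ ≫ (doubleXIso₀ f hi₀₁).inv := by
  dsimp [mkHomToDouble]
  rw [if_pos rfl, Category.id_comp, Category.comp_id]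

@[simp]
lemma mkHomToDouble_f₁ :
    (mkHomToDouble hi₀₁ h φ₀ φ₁ comm hφ).f i₁ = φ₁ ≫ (doubleXIso₁ f hi₀₁ h).inv := by
  dsimp [mkHomToDouble]
  rw [dif_neg h.symm, if_pos rfl, Category.id_comp, Category.comp_id]

end

end HomologicalComplex

namespace CochainComplex

open HomologicalComplex

/-- A splitting of a cochain complex `K`: factorizations `K.X i ⟶ B i ⟶ K.X (i + 1)` of the
differentials through split epimorphisms and monomorphisms, and the splittings
`K.X i ≅ Z i ⊞ B i` that they induce. -/
structure Splitting {C : Type*} [Category C] [Preadditive C] (K : CochainComplex C ℤ) where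
  /-- the coboundaries -/
  B : ℤ → C
  /-- the cocycles -/
  Z : ℤ → C
  /-- the projection onto the coboundaries -/
  e (i : ℤ) : K.X i ⟶ B i
  /-- the inclusion of the coboundaries -/
  m (i : ℤ) : B i ⟶ K.X (i + 1)
  /-- the section of the projection -/
  s (i : ℤ) : B i ⟶ K.X i
  /-- the inclusion of the cocycles -/
  z (i : ℤ) : Z i ⟶ K.X i
  /-- the retraction onto the cocycles -/
  p (i : ℤ) : K.X i ⟶ Z i
  e_m (i : ℤ) : e i ≫ m i = K.d i (i + 1)
  s_e (i : ℤ) : s i ≫ e i = 𝟙 (B i)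
  z_p (i : ℤ) : z i ≫ p i = 𝟙 (Z i)
  total (i : ℤ) : e i ≫ s i + p i ≫ z i = 𝟙 (K.X i)
  m_e (i : ℤ) : m i ≫ e (i + 1) = 0

namespace Splitting

variable {C : Type*} [Category C] [Preadditive C] {K : CochainComplex C ℤ} (S : K.Splitting)

attribute [simp] e_m s_e z_p m_e

@[simp]
lemma s_e_assoc (i : ℤ) {Y : C} (f : S.B i ⟶ Y) : S.s i ≫ S.e i ≫ f = f := by
  rw [← Category.assoc, S.s_e, Category.id_comp]

@[simp]
lemma z_p_assoc (i : ℤ) {Y : C} (f : S.Z i ⟶ Y) : S.z i ≫ S.p i ≫ f = f := by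
  rw [← Category.assoc, S.z_p, Category.id_comp]

@[simp]
lemma m_e_assoc (i : ℤ) {Y : C} (f : S.B (i + 1) ⟶ Y) : S.m i ≫ S.e (i + 1) ≫ f = 0 := by
  rw [← Category.assoc, S.m_e, zero_comp]

@[simp]
lemma z_e (i : ℤ) : S.z i ≫ S.e i = 0 := by
  have h := S.z i ≫= S.total i =≫ S.e i
  simpa using h

@[simp]
lemma z_e_assoc (i : ℤ) {Y : C} (f : S.B i ⟶ Y) : S.z i ≫ S.e i ≫ f = 0 := by
  rw [← Category.assoc, S.z_e, zero_comp]

@[simp]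
lemma s_p (i : ℤ) : S.s i ≫ S.p i = 0 := by
  have h := S.s i ≫= S.total i =≫ S.p i
  simpa using h

@[simp]
lemma s_p_assoc (i : ℤ) {Y : C} (f : S.Z i ⟶ Y) : S.s i ≫ S.p i ≫ f = 0 := by
  rw [← Category.assoc, S.s_p, zero_comp]

@[simp]
lemma z_d (i j : ℤ) : S.z i ≫ K.d i j = 0 := by
  by_cases h : i + 1 = j
  · subst h
    rw [← S.e_m, z_e_assoc]
  · rw [K.shape _ _ h, comp_zero]

@[simp]
lemma d_e (i j : ℤ) : K.d i j ≫ S.e j = 0 := by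
  by_cases h : i + 1 = j
  · subst h
    rw [← S.e_m, Category.assoc, m_e, comp_zero]
  · rw [K.shape _ _ h, zero_comp]

@[simp]
lemma m_p_z (i : ℤ) : S.m i ≫ S.p (i + 1) ≫ S.z (i + 1) = S.m i := by
  have h := S.m i ≫= S.total (i + 1)
  simpa using h

@[simp]
lemma s_d (i : ℤ) : S.s i ≫ K.d i (i + 1) = S.m i := by
  rw [← S.e_m, s_e_assoc]

variable [HasZeroObject C]

/-- The two-term complex `B i ⟶ Z (i + 1)`. -/
noncomputable abbrev piece (i : ℤ) : CochainComplex C ℤ :=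
  double (c := .up ℤ) (S.m i ≫ S.p (i + 1)) (show (ComplexShape.up ℤ).Rel i (i + 1) by simp)

/-- The inclusion of a two-term piece. -/
noncomputable def incl (i : ℤ) : S.piece i ⟶ K :=
  mkHomFromDouble _ (by simp) (S.s i) (S.z (i + 1)) (by simp) (by simp)

/-- The projection onto a two-term piece. -/
noncomputable def proj (i : ℤ) : K ⟶ S.piece i :=
  mkHomToDouble _ (by simp) (S.e i) (S.p (i + 1)) (by rw [← Category.assoc, S.e_m]) (by simp)

lemma proj_incl_f₀ (i : ℤ) : (S.proj i).f i ≫ (S.incl i).f i = S.e i ≫ S.s i := by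
  simp [proj, incl]

lemma proj_incl_f₁ (i : ℤ) :
    (S.proj i).f (i + 1) ≫ (S.incl i).f (i + 1) = S.p (i + 1) ≫ S.z (i + 1) := by
  simp [proj, incl]

lemma proj_incl_f_eq_zero (i n : ℤ) (h₀ : n ≠ i) (h₁ : n ≠ i + 1) :
    (S.proj i).f n ≫ (S.incl i).f n = 0 := by
  rw [(isZero_double_X _ _ n h₀ h₁ : IsZero ((S.piece i).X n)).eq_zero_of_tgt ((S.proj i).f n),
    zero_comp]

lemma incl_proj_self (i : ℤ) : S.incl i ≫ S.proj i = 𝟙 _ := by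
  apply from_double_hom_ext
  · simp [proj, incl, piece]
  · simp [proj, incl, piece]

lemma incl_proj_of_ne {i j : ℤ} (h : i ≠ j) : S.incl i ≫ S.proj j = 0 := by
  apply from_double_hom_ext
  · by_cases hj : i = j + 1
    · subst hj
      simp [proj, incl]
    · exact (isZero_double_X _ _ i h hj : IsZero ((S.piece j).X i)).eq_of_tgt _ _
  · by_cases hj : i + 1 = j
    · subst hj
      simp [proj, incl]
    · exact (isZero_double_X _ _ (i + 1) hj (by lia) :
        IsZero ((S.piece j).X (i + 1))).eq_of_tgt _ _

/-- A split complex concentrated in degrees `a, …, a + n` is the direct sum of its two-term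
pieces. -/
theorem nonempty_iso_biproduct [HasFiniteBiproducts (CochainComplex C ℤ)] {a : ℤ} {n : ℕ}
    (h₁ : ∀ i < a, IsZero (K.X i)) (h₂ : ∀ i, a + n < i → IsZero (K.X i)) :
    Nonempty (K ≅ ⨁ fun j : Fin (n + 2) ↦ S.piece (a - 1 + (j : ℕ))) := by
  -- Pieces start at `a - 1` because the cocycles of degree `a` sit in the upper degree of that
  -- piece.
  let b : Bicone fun j : Fin (n + 2) ↦ S.piece (a - 1 + (j : ℕ)) :=
    { pt := K
      π j := S.proj _
      ι j := S.incl _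
      ι_π j j' := by
        split_ifs with h
        · subst h
          exact S.incl_proj_self _
        · exact S.incl_proj_of_ne fun h' ↦ h (Fin.ext (by lia)) }
  refine ⟨biproduct.uniqueUpToIso _ (b := b) (isBilimitOfTotal b ?_)⟩
  ext i
  have hsum : (∑ j, b.π j ≫ b.ι j).f i = ∑ j, (b.π j).f i ≫ (b.ι j).f i :=
    Functor.map_sum (HomologicalComplex.eval _ _ i) (fun j ↦ b.π j ≫ b.ι j) Finset.univ
  by_cases hi : i < a
  · exact (h₁ i hi).eq_of_src _ _
  by_cases hi' : a + n < i
  · exact (h₂ i hi').eq_of_src _ _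
  obtain ⟨k, rfl⟩ : ∃ k : ℕ, i = a - 1 + k + 1 := ⟨(i - a).toNat, by lia⟩
  -- Only two pieces meet degree `i`: the one starting there contributes `e ≫ s`, the preceding one
  -- `p ≫ z`.
  rw [hsum, Finset.sum_eq_add (⟨k + 1, by lia⟩ : Fin (n + 2)) ⟨k, by lia⟩ (by simp)]
  · have e₁ : (b.π ⟨k + 1, by lia⟩).f (a - 1 + k + 1) ≫ (b.ι ⟨k + 1, by lia⟩).f (a - 1 + k + 1) =
        S.e _ ≫ S.s _ := by
      have h : a - 1 + (k : ℤ) + 1 = a - 1 + (k + 1 : ℕ) := by lia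
      rw [h]
      exact S.proj_incl_f₀ _
    rw [e₁]
    exact (congrArg _ (S.proj_incl_f₁ _)).trans (S.total _)
  · rintro j - ⟨hj₁, hj₂⟩
    exact S.proj_incl_f_eq_zero _ _ (fun h ↦ hj₁ (Fin.ext (by lia)))
      (fun h ↦ hj₂ (Fin.ext (by lia)))
  · simp
  · simp

end Splitting

end CochainComplex

/-! ### Principal ideal domains. -/

section

variable {A : Type u} [CommRing A] [IsDomain A] [IsPrincipalIdealRing A]

theorem Submodule.projective_of_isPrincipalIdealRing {M : Type*} [AddCommGroup M] [Module A M]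
    [Module.Projective A M] [Module.Finite A M] (N : Submodule A M) : Module.Projective A N := by
  exact inferInstance

/-- Over a principal ideal domain, every complex of finitely generated projective modules
splits. -/
noncomputable def IsFiniteProjectiveComplex.splitting {K : CochainComplex (ModuleCat.{u} A) ℤ}
    {a b : ℤ} (h : IsFiniteProjectiveComplex K a b) : K.Splitting :=
  have (i : ℤ) : Module.Finite A (K.X i) := h.finite i
  have (i : ℤ) : Module.Projective A (K.X i) := h.projective i
  have (i : ℤ) : Module.Projective A (K.d i (i + 1)).hom.range :=
    Submodule.projective_of_isPrincipalIdealRing _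
  -- Projectivity of the range provides a section of each differential onto its image.
  have hs (i : ℤ) := Module.projective_lifting_property (K.d i (i + 1)).hom.rangeRestrict
    LinearMap.id (LinearMap.surjective_rangeRestrict _)
  let s (i : ℤ) := (hs i).choose
  have hs' (i : ℤ) (y : (K.d i (i + 1)).hom.range) : (K.d i (i + 1)).hom (s i y) = y :=
    congrArg Subtype.val (LinearMap.congr_fun (hs i).choose_spec y)
  { B i := ModuleCat.of A (K.d i (i + 1)).hom.range
    Z i := ModuleCat.of A (K.d i (i + 1)).hom.ker
    e i := ModuleCat.ofHom (K.d i (i + 1)).hom.rangeRestrict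
    m i := ModuleCat.ofHom (Submodule.subtype _)
    s i := ModuleCat.ofHom (s i)
    z i := ModuleCat.ofHom (Submodule.subtype _)
    p i := ModuleCat.ofHom (LinearMap.codRestrict _
      (LinearMap.id - s i ∘ₗ (K.d i (i + 1)).hom.rangeRestrict) fun x ↦ by
        simp [LinearMap.mem_ker, hs'])
    e_m i := rfl
    s_e i := by
      ext y
      exact hs' i y
    z_p i := by
      ext y
      have : (K.d i (i + 1)).hom.rangeRestrict y.1 = 0 := Subtype.ext y.2
      simp [this]
    total i := by
      ext y
      simp
    m_e i := by
      ext ⟨_, y, rfl⟩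
      exact ConcreteCategory.congr_hom (K.d_comp_d i (i + 1) (i + 1 + 1)) y }

theorem IsFiniteProjectiveComplex.isFiniteProjectiveOfLengthLE_piece
    {K : CochainComplex (ModuleCat.{u} A) ℤ} {a b : ℤ} (h : IsFiniteProjectiveComplex K a b)
    (i : ℤ) : IsFiniteProjectiveOfLengthLE (h.splitting.piece i) 1 := by
  have hP (N : ModuleCat.{u} A) (j : ℤ) (S : Submodule A (K.X j)) (e : N ≅ ModuleCat.of A S) :
      Module.Finite A N ∧ Module.Projective A N := by
    have := h.finite j
    have := h.projective j
    have := Submodule.projective_of_isPrincipalIdealRing S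
    exact ⟨Module.Finite.equiv e.symm.toLinearEquiv,
      Module.Projective.of_equiv e.symm.toLinearEquiv⟩
  have hz (j : ℤ) (h₀ : j ≠ i) (h₁ : j ≠ i + 1) : IsZero ((h.splitting.piece i).X j) :=
    HomologicalComplex.isZero_double_X _ _ j h₀ h₁
  have hX (j : ℤ) :
      Module.Finite A ((h.splitting.piece i).X j) ∧
        Module.Projective A ((h.splitting.piece i).X j) := by
    by_cases h₀ : j = i
    · subst h₀
      exact hP _ (j + 1) _ (HomologicalComplex.doubleXIso₀ _ _)
    by_cases h₁ : j = i + 1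
    · subst h₁
      exact hP _ (i + 1) _ (HomologicalComplex.doubleXIso₁ _ _ (by simp))
    have := ModuleCat.subsingleton_of_isZero (hz j h₀ h₁)
    exact ⟨inferInstance, inferInstance⟩
  exact ⟨i, i + 1, by simp, fun j ↦ (hX j).1, fun j ↦ (hX j).2,
    fun j hj ↦ hz j (by lia) (by lia), fun j hj ↦ hz j (by lia) (by lia)⟩

variable (A) in
/-- A principal ideal domain is strongly `1`-regular. -/
theorem isStronglyRRegular_one_of_isPrincipalIdealRing : IsStronglyRRegular A 1 := by
  rintro K ⟨P, a, b, hP, hK⟩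
  obtain ⟨e⟩ := hP.splitting.nonempty_iso_biproduct (n := (b - a).toNat) hP.isZero_of_lt
    (fun i hi ↦ hP.isZero_of_gt i (by lia))
  exact ⟨_, _, fun _ ↦ hP.isFiniteProjectiveOfLengthLE_piece _, hK.trans_iso e⟩

end

theorem corollary1p7 (A : Type u) [CommRing A] [IsLocalRing A] [IsNoetherianRing A] :
    (IsStronglyRegular A ↔ IsField A ∨ (IsRegularLocalRing A ∧ ringKrullDim A = 1)) ∧
    ((IsRegularLocalRing A ∧ ringKrullDim A = 1) ↔
      ∃ _ : IsDomain A, IsDiscreteValuationRing A) := by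
  refine ⟨⟨isField_or_isRegularLocalRing_of_isStronglyRegular, fun h ↦ ⟨1, ?_⟩⟩,
    isRegularLocalRing_and_ringKrullDim_eq_one_iff A⟩
  rcases h with h | h
  · have : IsDomain A := h.isDomain
    have : IsPrincipalIdealRing A := h.isPrincipalIdealRing
    exact isStronglyRRegular_one_of_isPrincipalIdealRing A
  · obtain ⟨_, _⟩ := (isRegularLocalRing_and_ringKrullDim_eq_one_iff A).1 h
    exact isStronglyRRegular_one_of_isPrincipalIdealRing A
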